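/- Let $\mathcal A$ be an abelian category. For an object $M$ of $\mathcal A$, let $\operatorname{add} M$ be the full subcategory of all direct factors of finite direct sums of copies of $M$. An $M$-resolution of an object $X$ is an exact sequence $\cdots\to M_2\to M_1\to M_0\to X\to 0$ in $\mathcal A$ with all $M_i\in\operatorname{add}M$ such that the induced sequence $\cdots\to\operatorname{Hom}_{\mathcal A}(M,M_1)\to\operatorname{Hom}_{\mathcal A}(M,M_0)\to\operatorname{Hom}_{\mathcal A}(M,X)\to 0$ of abelian groups is exact; it has finite length if $M_i=0$ for $i\gg 0$. The object $M$ is a representation generator of $\mathcal A$ if every object of $\mathcal A$ admits an $M$-resolution of finite length. For a ring $\Lambda$, let $\operatorname{mod}\Lambda$ be the category of finitely presented right $\Lambda$-modules; $\Lambda$ is right coherent if $\operatorname{mod}\Lambda$ is abelian. Let $\operatorname{pd}X\in\{0,1,2,\dots,\infty\}$ be the projective dimension of a right $\Lambda$-module $X$ (with $\operatorname{pd}0=0$), and let $\operatorname{gl.dim}\Lambda=\sup\{\operatorname{pd}X\}$ over all right $\Lambda$-modules $X$. For a triangulated category $\mathcal T$ and an object $X$, let $\langle X\rangle=\langle X\rangle_1$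 be the smallest full subcategory of $\mathcal T$ that contains $X$ and is closed under finite direct sums, direct factors and all shifts, and let $\langle X\rangle_{n+1}$ be the full subcategory of direct factors of objects $E$ that fit into an exact triangle $E'\to E\to E''\to\Sigma E'$ with $E'\in\langle X\rangle_n$ and $E''\in\langle X\rangle$. The dimension $\dim\mathcal T\in\{0,1,2,\dots,\infty\}$ is the least $n\ge 0$ such that $\langle X\rangle_{n+1}=\mathcal T$ for some object $X$, and $\infty$ if there is no such $n$. For an abelian category $\mathcal B$ let $\mathbf D^b(\mathcal B)$ be its bounded derived category. **Proposition.** Let $M$ be a representation generator of an abelian category $\mathcal A$, and let $\Gamma=\operatorname{End}_{\mathcal A}(M)$. Then $\Gamma$ is right coherent, and every finitely presented right $\Gamma$-module has finite projective dimension. Moreover, $$\dim\mathbf D^b(\mathcal A)\ \le\ \dim\mathbf D^b(\operatorname{mod}\Gamma)\ \le\ \sup\{\operatorname{pd}X\mid X\in\operatorname{mod}\Gamma\}\ \le\ \operatorname{gl.dim}\Gamma .$$ -/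

import Mathlib

open CategoryTheory CategoryTheory.Limits

universe w u v

namespace RepGen

/-! ### The dimension of a triangulated category -/

/-- The dimension of a triangulated category `T`: the least `n` such that `⟨X⟩_{n+1} = T` for some
object `X`, and `⊤` if there is no such `n`. Here `(singleton X).triangEnvelopeIter n` is
`⟨X⟩_{n+1}`: with `⟨X⟩` the closure of `X` under shifts, finite direct sums and direct factors, it
consists of the direct factors of the iterated extensions of `n + 1` objects of `⟨X⟩`. -/
noncomputable def triangulatedDim (T : Type*) [Category* T] [HasZeroObject T] [HasShift T ℤ]
    [Preadditive T] [∀ n : ℤ, (shiftFunctor T n).Additive] [Pretriangulated T] : ℕ∞ :=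
  ⨅ (n : ℕ) (_ : ∃ X : T, (ObjectProperty.singleton X).triangEnvelopeIter n = ⊤), (n : ℕ∞)

/-! ### The bounded derived category -/

/-- The bounded derived category of `A`: the full triangulated subcategory of the derived category
(the localization of cochain complexes at quasi-isomorphisms) on the objects that are bounded for
the canonical t-structure. -/
abbrev BoundedDerivedCategory (A : Type u) [Category.{v} A] [Abelian A]
    [HasDerivedCategory.{w} A] :=
  (DerivedCategory.TStructure.t (C := A)).bounded.FullSubcategory

/-- `dim D^b(A)`. -/
noncomputable def dimDb (A : Type u) [Category.{v} A] [Abelian A] : ℕ∞ :=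
  letI : HasDerivedCategory.{max u v} A := HasDerivedCategory.standard A
  triangulatedDim (BoundedDerivedCategory A)

/-! ### Right modules, finitely presented right modules, coherence -/

/-- The category of right `Λ`-modules. -/
abbrev RightMod (Λ : Type v) [Ring Λ] := ModuleCat.{v} Λᵐᵒᵖ

/-- The property of a right `Λ`-module of being finitely presented. -/
def isFinitelyPresented (Λ : Type v) [Ring Λ] : ObjectProperty (RightMod Λ) :=
  fun X => Module.FinitePresentation Λᵐᵒᵖ X

/-- `mod Λ`, the full subcategory of finitely presented right `Λ`-modules. -/
abbrev FPMod (Λ : Type v) [Ring Λ] := (isFinitelyPresented Λ).FullSubcategory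

/-- The ring `Λ` is right coherent if the category `mod Λ`, with its usual addition of morphisms,
is abelian. -/
class IsRightCoherent (Λ : Type v) [Ring Λ] : Prop where
  hasFiniteProducts : HasFiniteProducts (FPMod Λ)
  hasKernels : HasKernels (FPMod Λ)
  hasCokernels : HasCokernels (FPMod Λ)
  isNormalMonoCategory : IsNormalMonoCategory (FPMod Λ)
  isNormalEpiCategory : IsNormalEpiCategory (FPMod Λ)

/-- For a right coherent ring `Λ`, the category `mod Λ` is abelian. -/
noncomputable instance (Λ : Type v) [Ring Λ] [h : IsRightCoherent Λ] : Abelian (FPMod Λ) :=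
  letI := h.isNormalMonoCategory
  letI := h.isNormalEpiCategory
  { has_finite_products := h.hasFiniteProducts
    has_kernels := h.hasKernels
    has_cokernels := h.hasCokernels }

/-! ### Projective and global dimension -/

/-- The projective dimension of a right `Λ`-module, in the category of all right `Λ`-modules, with
the convention that the zero module has projective dimension `0`. -/
noncomputable def pd {Λ : Type v} [Ring Λ] (X : RightMod Λ) : ℕ∞ :=
  (projectiveDimension X).unbotD 0

/-- The (right) global dimension of `Λ`. -/
noncomputable def glDim (Λ : Type v) [Ring Λ] : ℕ∞ :=
  ⨆ X : RightMod Λ, pd X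

/-! ### Representation generators -/

variable {A : Type u} [Category.{v} A] [Abelian A]

/-- `add M`: the objects that are direct factors of a finite direct sum of copies of `M`. -/
def addClosure (M : A) : ObjectProperty A :=
  haveI : HasFiniteBiproducts A := Abelian.hasFiniteBiproducts
  fun X => ∃ n : ℕ, Nonempty (Retract X (⨁ fun _ : Fin n => M))

/-- An `M`-resolution of `X`: an exact sequence `⋯ ⟶ M₂ ⟶ M₁ ⟶ M₀ ⟶ X ⟶ 0` with all `Mᵢ` in
`add M` whose image under `Hom(M, -)` is an exact sequence of abelian groups. -/
structure MResolution (M X : A) where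
  /-- The complex `⋯ ⟶ M₂ ⟶ M₁ ⟶ M₀`. -/
  K : ChainComplex A ℕ
  mem_add : ∀ i, addClosure M (K.X i)
  /-- The augmentation `M₀ ⟶ X`. -/
  ε : K.X 0 ⟶ X
  d_ε : K.d 1 0 ≫ ε = 0
  epi_ε : Epi ε
  exact_zero : (ShortComplex.mk (K.d 1 0) ε d_ε).Exact
  exact_succ : ∀ i : ℕ,
    (ShortComplex.mk (K.d (i + 2) (i + 1)) (K.d (i + 1) i) (K.d_comp_d _ _ _)).Exact
  hom_surjective : Function.Surjective fun g : M ⟶ K.X 0 => g ≫ ε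
  hom_exact_zero :
    Function.Exact (fun g : M ⟶ K.X 1 => g ≫ K.d 1 0) (fun g : M ⟶ K.X 0 => g ≫ ε)
  hom_exact_succ : ∀ i : ℕ,
    Function.Exact (fun g : M ⟶ K.X (i + 2) => g ≫ K.d (i + 2) (i + 1))
      (fun g : M ⟶ K.X (i + 1) => g ≫ K.d (i + 1) i)

/-- An `M`-resolution has finite length if `Mᵢ = 0` for `i ≫ 0`. -/
def MResolution.FiniteLength {M X : A} (R : MResolution M X) : Prop :=
  ∃ n : ℕ, ∀ i, n ≤ i → IsZero (R.K.X i)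

/-- `M` is a representation generator if every object has an `M`-resolution of finite length. -/
def IsRepresentationGenerator (M : A) : Prop :=
  ∀ X : A, ∃ R : MResolution M X, R.FiniteLength

end RepGen

-- Put `Γ = End M` and `F = Hom(M, -)`. The first term of an `M`-resolution gives every object an
-- epimorphism from some `Mⁿ` along which maps from `M` lift. Hence `F` is fully faithful with
-- finitely presented values. Maps of finite free `Γ`-modules have the form `F f` with `f : Mᵐ ⟶
-- Mⁿ`, and `ker (F f) = F (ker f)` is finitely generated: this is coherence. A finitely presented
-- module is the cokernel of such an `F f`, so `F (ker f)` is a second syzygy of it; that has finite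
-- projective dimension because `F` turns a finite `M`-resolution into a projective resolution
-- (`MResolution.exists_hasProjectiveDimensionLT`).
--
-- For the first inequality, `F` has a left adjoint `G`, sending `coker (F f)` to `coker f`. It is
-- exact (`preservesMonomorphisms_leftAdjoint`) and `G F ≅ 𝟭`. Applying `F` termwise to bounded
-- complexes shows that `G` induces an essentially surjective triangulated functor on bounded
-- derived categories, and such functors do not raise the dimension.
--
-- For the second, let all projective dimensions be at most `n`. Projectives covering the cohomology
-- of `X` lift to a map `Z ⟶ X` from a finite sum of shifted projectives, and its fibre has the
-- syzygies as cohomology. Iterating builds `X` from `Γ` in `n` extensions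
-- (`triangEnvelopeIter_boundedSingle`).

universe w'

namespace RepGen

/-! ### Coherent rings and closure properties of finitely presented modules. -/

section Coherence

variable {R : Type*} [Ring R]

/-- Over a ring such that kernels of maps between finite free modules are finitely generated,
finitely generated submodules of finitely presented modules are finitely presented. -/
theorem finitePresentation_submodule
    (hR : ∀ (m n : ℕ) (f : (Fin m → R) →ₗ[R] (Fin n → R)), (LinearMap.ker f).FG)
    {Y : Type*} [AddCommGroup Y] [Module R Y] [Module.FinitePresentation R Y]
    (N : Submodule R Y) (hN : N.FG) : Module.FinitePresentation R N := by
  -- Inside a free module, the relations among generators of `N` form the kernel of a map between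
  -- free modules, so `hR` applies.
  have free (n : ℕ) (N : Submodule R (Fin n → R)) (hN : N.FG) :
      Module.FinitePresentation R N := by
    have : Module.Finite R N := Module.Finite.iff_fg.2 hN
    obtain ⟨k, g, hg⟩ := Module.Finite.exists_fin' R N
    refine Module.finitePresentation_of_surjective g hg ?_
    have := hR k n (N.subtype ∘ₗ g)
    rwa [LinearMap.ker_comp_of_ker_eq_bot _ (Submodule.ker_subtype N)] at this
  obtain ⟨n, m, π, g, hπ, hg⟩ := Module.FinitePresentation.exists_fin' R Y
  have hker : (LinearMap.ker π).FG := Module.FinitePresentation.fg_ker π hπ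
  -- The preimage is an extension of `N` by `ker π`, both finitely generated.
  have hN' : (N.comap π).FG := by
    refine Submodule.fg_of_fg_map_of_fg_inf_ker π ?_ ?_
    · rwa [Submodule.map_comap_eq_of_surjective hπ]
    · rwa [inf_eq_right.2 (LinearMap.ker_le_comap π)]
  have := free n _ hN'
  let ρ : N.comap π →ₗ[R] N := π.restrict fun x hx => hx
  have hρ : Function.Surjective ρ := by
    rintro ⟨y, hy⟩
    obtain ⟨x, rfl⟩ := hπ y
    exact ⟨⟨x, hy⟩, rfl⟩
  refine Module.finitePresentation_of_surjective ρ hρ ?_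
  refine Submodule.fg_of_fg_map_injective (N.comap π).subtype (Submodule.injective_subtype _) ?_
  convert hker using 1
  ext x
  simp only [Submodule.mem_map, LinearMap.mem_ker, Submodule.subtype_apply]
  constructor
  · rintro ⟨⟨x, hx⟩, h, rfl⟩
    exact congrArg Subtype.val h
  · intro h
    exact ⟨⟨x, by simp [h]⟩, Subtype.ext h, rfl⟩

theorem finitePresentation_ker
    (hR : ∀ (m n : ℕ) (f : (Fin m → R) →ₗ[R] (Fin n → R)), (LinearMap.ker f).FG)
    {X Y : Type*} [AddCommGroup X] [Module R X] [AddCommGroup Y] [Module R Y]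
    [Module.FinitePresentation R X] [Module.FinitePresentation R Y] (f : X →ₗ[R] Y) :
    Module.FinitePresentation R (LinearMap.ker f) := by
  have : Module.FinitePresentation R (LinearMap.range f) :=
    finitePresentation_submodule hR _ (Module.Finite.iff_fg.1 inferInstance)
  refine finitePresentation_submodule hR _ ?_
  rw [← LinearMap.ker_rangeRestrict]
  exact Module.FinitePresentation.fg_ker _ f.surjective_rangeRestrict

variable {Λ : Type v} [Ring Λ]

instance : (isFinitelyPresented Λ).IsClosedUnderIsomorphisms where
  of_iso e hX := by
    have : Module.FinitePresentation _ _ := hX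
    exact Module.FinitePresentation.of_equiv e.toLinearEquiv

instance : (isFinitelyPresented Λ).ContainsZero where
  exists_zero := ⟨ModuleCat.of _ PUnit, ModuleCat.isZero_of_subsingleton _,
    Module.FinitePresentation.of_subsingleton PUnit⟩

instance : (isFinitelyPresented Λ).IsClosedUnderFiniteProducts where
  isClosedUnderLimitsOfShape J _ := .mk' (by
    rintro X ⟨F, hF⟩
    have (j : J) : Module.FinitePresentation Λᵐᵒᵖ (F.obj ⟨j⟩) := hF ⟨j⟩
    exact (isFinitelyPresented Λ).prop_of_iso
      (IsLimit.conePointsIsoOfNatIso (ModuleCat.productConeIsLimit fun j : J => F.obj ⟨j⟩)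
        (limit.isLimit F) Discrete.natIsoFunctor.symm)
      (Module.FinitePresentation.pi fun j : J => F.obj ⟨j⟩))

instance : (isFinitelyPresented Λ).IsClosedUnderCokernels where
  cokernels_le := by
    rintro _ ⟨f, k, hk, hf⟩
    have : Module.FinitePresentation _ _ := hf.1
    have : Module.FinitePresentation _ _ := hf.2
    have hfg : (LinearMap.range f.hom).FG := Module.Finite.iff_fg.1 inferInstance
    have : Module.FinitePresentation Λᵐᵒᵖ (_ ⧸ LinearMap.range f.hom) :=
      Module.finitePresentation_of_surjective (LinearMap.range f.hom).mkQ
        (Submodule.mkQ_surjective _) (by rwa [Submodule.ker_mkQ])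
    exact (isFinitelyPresented Λ).prop_of_iso
      ((ModuleCat.cokernelIsColimit f).coconePointUniqueUpToIso hk) this

theorem isClosedUnderKernels_isFinitelyPresented
    (hΛ : ∀ (m n : ℕ) (f : (Fin m → Λᵐᵒᵖ) →ₗ[Λᵐᵒᵖ] (Fin n → Λᵐᵒᵖ)), (LinearMap.ker f).FG) :
    (isFinitelyPresented Λ).IsClosedUnderKernels where
  kernels_le := by
    rintro _ ⟨f, k, hk, hf⟩
    have : Module.FinitePresentation _ _ := hf.1
    have : Module.FinitePresentation _ _ := hf.2
    exact (isFinitelyPresented Λ).prop_of_iso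
      ((ModuleCat.kernelIsLimit f).conePointUniqueUpToIso hk) (finitePresentation_ker hΛ f.hom)

theorem isRightCoherent_of_isClosedUnderKernels [(isFinitelyPresented Λ).IsClosedUnderKernels] :
    IsRightCoherent Λ where
  hasFiniteProducts := inferInstance
  hasKernels := inferInstance
  hasCokernels := inferInstance
  isNormalMonoCategory := inferInstance
  isNormalEpiCategory := inferInstance

end Coherence

/-! ### The functor `Hom(M, -)`: full faithfulness and coherence of `End M`. -/

section HomFunctor

variable {A : Type u} [Category.{v} A] [Abelian A]

attribute [local instance] Abelian.hasFiniteBiproducts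

/-- The direct sum of `n` copies of `M`. -/
noncomputable abbrev power (M : A) (n : ℕ) : A := ⨁ fun _ : Fin n => M

theorem op_smul_hom {M X : A} (a : End M) (g : M ⟶ X) : MulOpposite.op a • g = a ≫ g := rfl

/-- `Hom(M, Mⁿ)` is a free right `End M`-module of rank `n`. -/
noncomputable def homPowerEquiv (M : A) (n : ℕ) :
    (M ⟶ power M n) ≃ₗ[(End M)ᵐᵒᵖ] (Fin n → (End M)ᵐᵒᵖ) where
  toFun g i := MulOpposite.op (g ≫ biproduct.π (fun _ : Fin n => M) i)
  invFun x := biproduct.lift fun i => (x i).unop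
  map_add' g h := by
    funext i
    exact congrArg MulOpposite.op (Preadditive.add_comp _ _ _ g h _)
  map_smul' a g := by
    funext i
    exact congrArg MulOpposite.op (Category.assoc a.unop g _)
  left_inv g := biproduct.hom_ext _ _ fun i => biproduct.lift_π _ _
  right_inv x := by
    funext i
    exact congrArg MulOpposite.op (biproduct.lift_π _ _)

theorem exists_map_coyonedaObj_eq {M : A} {n : ℕ} {Y : A}
    (φ : (preadditiveCoyonedaObj M).obj (power M n) ⟶ (preadditiveCoyonedaObj M).obj Y) :
    ∃ g : power M n ⟶ Y, (preadditiveCoyonedaObj M).map g = φ := by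
  let ψ : (M ⟶ power M n) →ₗ[(End M)ᵐᵒᵖ] (M ⟶ Y) := φ.hom
  refine ⟨biproduct.desc fun i => ψ (biproduct.ι (fun _ : Fin n => M) i), ?_⟩
  refine ModuleCat.hom_ext (LinearMap.ext fun (x : M ⟶ power M n) => ?_)
  change x ≫ _ = ψ x
  have hx : x = ∑ i, (x ≫ biproduct.π (fun _ : Fin n => M) i) ≫
      biproduct.ι (fun _ : Fin n => M) i := by
    simp_rw [Category.assoc, ← Preadditive.comp_sum, biproduct.total, Category.comp_id]
  have hψ (a : End M) (g : M ⟶ power M n) : ψ (a ≫ g) = a ≫ ψ g := by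
    rw [← op_smul_hom, map_smul, op_smul_hom]
  conv_lhs => rw [hx]
  conv_rhs => rw [hx]
  rw [Preadditive.sum_comp, map_sum]
  refine Finset.sum_congr rfl fun i _ => ?_
  rw [hψ, Category.assoc, biproduct.ι_desc]

instance finitePresentation_hom_power (M : A) (n : ℕ) :
    Module.FinitePresentation (End M)ᵐᵒᵖ (M ⟶ power M n) :=
  Module.FinitePresentation.of_equiv (homPowerEquiv M n).symm

/-- Every object is a quotient of a finite direct sum of copies of `M` along which all morphisms from
`M` lift. -/
theorem IsRepresentationGenerator.exists_cover {M : A} (hM : IsRepresentationGenerator M) (X : A) :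
    ∃ (n : ℕ) (p : power M n ⟶ X), Epi p ∧ Function.Surjective fun g : M ⟶ power M n => g ≫ p := by
  obtain ⟨R, -⟩ := hM X
  obtain ⟨n, ⟨r⟩⟩ := R.mem_add 0
  have := R.epi_ε
  have : Epi r.r := inferInstance
  refine ⟨n, r.r ≫ R.ε, epi_comp r.r R.ε, fun g => ?_⟩
  obtain ⟨h, rfl⟩ := R.hom_surjective g
  exact ⟨h ≫ r.i, by simp⟩

variable {M : A} (hM : IsRepresentationGenerator M)
include hM

theorem IsRepresentationGenerator.faithful : (preadditiveCoyonedaObj M).Faithful where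
  map_injective {X Y f g} h := by
    obtain ⟨n, p, hp, -⟩ := hM.exists_cover X
    rw [← cancel_epi p]
    refine biproduct.hom_ext' _ _ fun i => ?_
    have : (biproduct.ι (fun _ : Fin n => M) i ≫ p) ≫ f =
        (biproduct.ι (fun _ : Fin n => M) i ≫ p) ≫ g :=
      LinearMap.congr_fun (congrArg ModuleCat.Hom.hom h)
        (biproduct.ι (fun _ : Fin n => M) i ≫ p : M ⟶ X)
    simpa only [Category.assoc] using this

/-- On a cover `p : Mⁿ ⟶ X` the composite comes from some `g : Mⁿ ⟶ Y`, by freeness; faithfulness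
shows that `g` kills `ker p`, so it descends to `X`. -/
theorem IsRepresentationGenerator.full : (preadditiveCoyonedaObj M).Full where
  map_surjective {X Y} φ := by
    have := hM.faithful
    obtain ⟨n, p, hp, hp'⟩ := hM.exists_cover X
    have := (ModuleCat.epi_iff_surjective ((preadditiveCoyonedaObj M).map p)).2 hp'
    obtain ⟨g, hg⟩ := exists_map_coyonedaObj_eq ((preadditiveCoyonedaObj M).map p ≫ φ)
    have hg' : kernel.ι p ≫ g = 0 := (preadditiveCoyonedaObj M).map_injective (by
      rw [Functor.map_comp, hg, ← Functor.map_comp_assoc, kernel.condition,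
        Functor.map_zero, Functor.map_zero, zero_comp])
    refine ⟨Abelian.epiDesc p g hg', ?_⟩
    rw [← cancel_epi ((preadditiveCoyonedaObj M).map p), ← Functor.map_comp, Abelian.comp_epiDesc,
      hg]

theorem IsRepresentationGenerator.finite_hom (X : A) : Module.Finite (End M)ᵐᵒᵖ (M ⟶ X) := by
  obtain ⟨n, p, hp, hp'⟩ := hM.exists_cover X
  let φ : (M ⟶ power M n) →ₗ[(End M)ᵐᵒᵖ] (M ⟶ X) := ((preadditiveCoyonedaObj M).map p).hom
  exact Module.Finite.of_surjective φ hp'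

/-- By left exactness this kernel is the image of `Hom(M, ker f)`, which is a quotient of a finite
free module. -/
theorem IsRepresentationGenerator.fg_ker {X Y : A} (f : X ⟶ Y) :
    (LinearMap.ker ((preadditiveCoyonedaObj M).map f).hom).FG := by
  have : Module.Finite (End M)ᵐᵒᵖ ((preadditiveCoyonedaObj M).obj (kernel f)) :=
    hM.finite_hom (kernel f)
  have h : LinearMap.ker ((preadditiveCoyonedaObj M).map f).hom =
      LinearMap.range ((preadditiveCoyonedaObj M).map (kernel.ι f)).hom := by
    ext x
    constructor
    · intro (hx : x ≫ f = 0)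
      exact ⟨kernel.lift f x hx, kernel.lift_ι f x hx⟩
    · rintro ⟨(y : M ⟶ kernel f), rfl⟩
      have : (y ≫ kernel.ι f) ≫ f = 0 := by simp
      exact this
  rw [h]
  exact Module.Finite.iff_fg.1 inferInstance

theorem IsRepresentationGenerator.isFinitelyPresented_hom (X : A) :
    isFinitelyPresented (End M) ((preadditiveCoyonedaObj M).obj X) := by
  obtain ⟨n, p, hp, hp'⟩ := hM.exists_cover X
  have : Module.FinitePresentation (End M)ᵐᵒᵖ ((preadditiveCoyonedaObj M).obj (power M n)) :=
    finitePresentation_hom_power M n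
  exact Module.finitePresentation_of_surjective ((preadditiveCoyonedaObj M).map p).hom hp'
    (hM.fg_ker p)

theorem IsRepresentationGenerator.fg_ker_free (m n : ℕ)
    (f : (Fin m → (End M)ᵐᵒᵖ) →ₗ[(End M)ᵐᵒᵖ] (Fin n → (End M)ᵐᵒᵖ)) : (LinearMap.ker f).FG := by
  let φ : (M ⟶ power M m) →ₗ[(End M)ᵐᵒᵖ] (M ⟶ power M n) :=
    (homPowerEquiv M n).symm.toLinearMap ∘ₗ f ∘ₗ (homPowerEquiv M m).toLinearMap
  obtain ⟨g, hg⟩ := exists_map_coyonedaObj_eq (M := M) (ModuleCat.ofHom φ)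
  have h := hM.fg_ker g
  rw [hg] at h
  have h' : LinearMap.ker f = (LinearMap.ker φ).map (homPowerEquiv M m).toLinearMap := by
    ext x
    simp [φ, Submodule.mem_map_equiv]
  rw [h']
  exact h.map _

theorem IsRepresentationGenerator.isClosedUnderKernels :
    (isFinitelyPresented (End M)).IsClosedUnderKernels :=
  isClosedUnderKernels_isFinitelyPresented hM.fg_ker_free

end HomFunctor

/-! ### Finite projective dimension along exact sequences. -/

section ProjectiveDimension

variable {C : Type u} [Category.{v} C] [Abelian C]

theorem _root_.CategoryTheory.ShortComplex.shortExact_kernel {X Y : C} (p : X ⟶ Y) [Epi p] :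
    (ShortComplex.mk (kernel.ι p) p (kernel.condition p)).ShortExact where
  exact := ShortComplex.exact_kernel p

theorem exists_hasProjectiveDimensionLT_of_epi {P X : C} (p : P ⟶ X) [Epi p] [Projective P]
    (h : ∃ n, HasProjectiveDimensionLT (kernel p) n) : ∃ n, HasProjectiveDimensionLT X n := by
  obtain ⟨n, hn⟩ := h
  exact ⟨n + 1, (ShortComplex.shortExact_kernel p).hasProjectiveDimensionLT_X₃ n hn
    (hasProjectiveDimensionLT_of_ge P 1 (n + 1) (by lia))⟩

/-- By exactness `ker g` is the image of `f`, a quotient of the projective `X₁` by `ker f`. This is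
one step along a projective resolution. -/
theorem exists_hasProjectiveDimensionLT_kernel {S : ShortComplex C} (hS : S.Exact)
    [Projective S.X₁] (h : ∃ n, HasProjectiveDimensionLT (kernel S.f) n) :
    ∃ n, HasProjectiveDimensionLT (kernel S.g) n := by
  have : Epi (kernel.lift S.g S.f S.zero) := hS.epi_kernelLift
  have e : kernel (kernel.lift S.g S.f S.zero) ≅ kernel S.f :=
    (kernelCompMono (kernel.lift S.g S.f S.zero) (kernel.ι S.g)).symm ≪≫
      kernelIsoOfEq (kernel.lift_ι _ _ _)
  obtain ⟨n, hn⟩ := h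
  exact exists_hasProjectiveDimensionLT_of_epi (kernel.lift S.g S.f S.zero)
    ⟨n, hasProjectiveDimensionLT_of_iso e.symm n⟩

end ProjectiveDimension

/-! ### Finite projective dimension of finitely presented `End M`-modules. -/

section

variable {A : Type u} [Category.{v} A] [Abelian A] {M : A}

attribute [local instance] Abelian.hasFiniteBiproducts

theorem projective_coyonedaObj_power (M : A) (n : ℕ) :
    Projective ((preadditiveCoyonedaObj M).obj (power M n)) := by
  have : Module.Projective (End M)ᵐᵒᵖ ((preadditiveCoyonedaObj M).obj (power M n)) :=
    Module.Projective.of_equiv (homPowerEquiv M n).symm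
  infer_instance

theorem projective_coyonedaObj_of_addClosure {X : A} (hX : addClosure M X) :
    Projective ((preadditiveCoyonedaObj M).obj X) := by
  obtain ⟨n, ⟨r⟩⟩ := hX
  have := projective_coyonedaObj_power M n
  exact (r.map (preadditiveCoyonedaObj M)).projective

theorem MResolution.exists_hasProjectiveDimensionLT {X : A} (R : MResolution M X)
    (hR : R.FiniteLength) :
    ∃ n, HasProjectiveDimensionLT ((preadditiveCoyonedaObj M).obj X) n := by
  let F := preadditiveCoyonedaObj M
  have proj (i : ℕ) : Projective (F.obj (R.K.X i)) :=
    projective_coyonedaObj_of_addClosure (R.mem_add i)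
  obtain ⟨N, hN⟩ := hR
  -- Descending induction on the degree: `k` bounds the distance from `i` to `N`, beyond which the
  -- resolution vanishes.
  have key (k : ℕ) : ∀ i, N ≤ i + k →
      ∃ n, HasProjectiveDimensionLT (kernel (F.map (R.K.d (i + 1) i))) n := by
    induction k with
    | zero =>
      intro i hi
      have h0 : IsZero (F.obj (R.K.X (i + 1))) := F.map_isZero (hN _ (by lia))
      exact ⟨0, (IsZero.of_mono (kernel.ι _) h0).hasProjectiveDimensionLT_zero⟩
    | succ k ih =>
      intro i hi
      have : Projective (F.obj (R.K.X (i + 1 + 1))) := proj _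
      refine exists_hasProjectiveDimensionLT_kernel
        (S := .mk (F.map (R.K.d (i + 2) (i + 1))) (F.map (R.K.d (i + 1) i)) ?_) ?_ (ih (i + 1) (by lia))
      · rw [← F.map_comp, R.K.d_comp_d, F.map_zero]
      · exact (ShortComplex.ShortExact.moduleCat_exact_iff_function_exact _).2 (R.hom_exact_succ i)
  have : Epi (F.map R.ε) := (ModuleCat.epi_iff_surjective _).2 R.hom_surjective
  refine exists_hasProjectiveDimensionLT_of_epi (F.map R.ε) ?_
  refine exists_hasProjectiveDimensionLT_kernel
    (S := .mk (F.map (R.K.d 1 0)) (F.map R.ε) ?_) ?_ (key N 0 (by lia))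
  · rw [← F.map_comp, R.d_ε, F.map_zero]
  · exact (ShortComplex.ShortExact.moduleCat_exact_iff_function_exact _).2 R.hom_exact_zero

/-- A finitely presented module over `End M` is a cokernel of `Hom(M, f)` for a morphism `f`
between finite direct sums of copies of `M`. -/
theorem exists_presentation (Y : RightMod (End M)) (hY : isFinitelyPresented (End M) Y) :
    ∃ (m n : ℕ) (f : power M m ⟶ power M n) (π : (preadditiveCoyonedaObj M).obj (power M n) ⟶ Y)
      (w : (preadditiveCoyonedaObj M).map f ≫ π = 0),
      Epi π ∧ (ShortComplex.mk _ π w).Exact := by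
  have : Module.FinitePresentation (End M)ᵐᵒᵖ Y := hY
  obtain ⟨n, m, π, g, hπ, hg⟩ := Module.FinitePresentation.exists_fin' (End M)ᵐᵒᵖ Y
  let φ : (M ⟶ power M m) →ₗ[(End M)ᵐᵒᵖ] (M ⟶ power M n) :=
    (homPowerEquiv M n).symm.toLinearMap ∘ₗ g ∘ₗ (homPowerEquiv M m).toLinearMap
  let π' : (M ⟶ power M n) →ₗ[(End M)ᵐᵒᵖ] Y := π ∘ₗ (homPowerEquiv M n).toLinearMap
  have hex : Function.Exact φ π' := by
    intro x
    simp only [φ, π', LinearMap.comp_apply, LinearEquiv.coe_coe, Set.mem_range]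
    rw [hg]
    constructor
    · rintro ⟨y, hy⟩
      exact ⟨(homPowerEquiv M m).symm y, by simp [hy]⟩
    · rintro ⟨y, rfl⟩
      exact ⟨homPowerEquiv M m y, by simp⟩
  obtain ⟨f, hf⟩ := exists_map_coyonedaObj_eq (M := M) (ModuleCat.ofHom φ)
  have hex' : Function.Exact ((preadditiveCoyonedaObj M).map f).hom π' := by
    rw [hf]
    exact hex
  have w : (preadditiveCoyonedaObj M).map f ≫ ModuleCat.ofHom π' = 0 :=
    ModuleCat.hom_ext (LinearMap.ext hex'.apply_apply_eq_zero)
  refine ⟨m, n, f, ModuleCat.ofHom π', w, ?_, ?_⟩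
  · exact (ModuleCat.epi_iff_surjective _).2 (hπ.comp (homPowerEquiv M n).surjective)
  · exact (ShortComplex.ShortExact.moduleCat_exact_iff_function_exact _).2 hex'

theorem IsRepresentationGenerator.exists_hasProjectiveDimensionLT (hM : IsRepresentationGenerator M)
    (Y : RightMod (End M)) (hY : isFinitelyPresented (End M) Y) :
    ∃ n, HasProjectiveDimensionLT Y n := by
  obtain ⟨m, n, f, π, w, hπ, hex⟩ := exists_presentation Y hY
  have := projective_coyonedaObj_power M n
  have := projective_coyonedaObj_power M m
  refine exists_hasProjectiveDimensionLT_of_epi π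
    (exists_hasProjectiveDimensionLT_kernel hex ?_)
  obtain ⟨R, hR⟩ := hM (kernel f)
  obtain ⟨k, hk⟩ := R.exists_hasProjectiveDimensionLT hR
  exact ⟨k, hasProjectiveDimensionLT_of_iso (PreservesKernel.iso (preadditiveCoyonedaObj M) f) k⟩

end

/-! ### The exact left adjoint. -/

section LeftAdjoint

variable {A B : Type*} [Category* A] [Category* B] [Abelian A] [Abelian B] (F : A ⥤ B)
  [F.Additive] [F.Full] [F.Faithful]

/-- A fully faithful functor such that every object of the target is the cokernel of a morphism in
its image has a left adjoint. -/
theorem isRightAdjoint_of_presentation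
    (hF : ∀ Y : B, ∃ (X₁ X₂ : A) (f : X₁ ⟶ X₂) (π : F.obj X₂ ⟶ Y) (w : F.map f ≫ π = 0),
      Nonempty (IsColimit (CokernelCofork.ofπ π w))) : F.IsRightAdjoint := by
  have (Y : B) : HasInitial (StructuredArrow Y F) := by
    obtain ⟨X₁, X₂, f, π, w, ⟨hπ⟩⟩ := hF Y
    have : Epi π := Cofork.IsColimit.epi hπ
    -- The value of the adjoint at `Y` is `coker f`, and `η` is the unit.
    let η : Y ⟶ F.obj (cokernel f) := (CokernelCofork.IsColimit.desc' hπ (F.map (cokernel.π f))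
      (by rw [← F.map_comp, cokernel.condition, F.map_zero])).1
    have hη : π ≫ η = F.map (cokernel.π f) := (CokernelCofork.IsColimit.desc' hπ _ _).2
    have exist (Z : StructuredArrow Y F) : ∃ k : cokernel f ⟶ Z.right, η ≫ F.map k = Z.hom := by
      obtain ⟨h, hh⟩ := F.map_surjective (π ≫ Z.hom)
      have hf : f ≫ h = 0 := F.map_injective (by
        rw [F.map_comp, hh, reassoc_of% w, zero_comp, F.map_zero])
      refine ⟨cokernel.desc f h hf, ?_⟩
      rw [← cancel_epi π, reassoc_of% hη, ← F.map_comp, cokernel.π_desc, hh]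
    refine IsInitial.hasInitial (X := StructuredArrow.mk η) (IsInitial.ofUniqueHom
      (fun Z => StructuredArrow.homMk (exist Z).choose (exist Z).choose_spec) fun Z m => ?_)
    ext
    -- Uniqueness is tested in `A`, since `F.map (cokernel.π f)` need not be an epimorphism.
    rw [← cancel_epi (cokernel.π f)]
    refine F.map_injective ?_
    have h₁ : η ≫ F.map m.right = Z.hom := StructuredArrow.w m
    have h₂ := (exist Z).choose_spec
    rw [F.map_comp, F.map_comp, ← hη, Category.assoc, Category.assoc, h₁]
    exact congrArg (π ≫ ·) h₂.symm
  exact isRightAdjointOfStructuredArrowInitials F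

variable {F} {G : B ⥤ A} (adj : G ⊣ F)
include adj

/-- The left adjoint of a fully faithful functor preserves monomorphisms if all objects of its
source are quotients of objects in the image of the functor. -/
theorem preservesMonomorphisms_leftAdjoint
    (hF : ∀ Y : B, ∃ (N : A) (p : F.obj N ⟶ Y), Epi p) : G.PreservesMonomorphisms where
  preserves {Y₁ Y₂} i hi := by
    have : G.Additive := adj.left_adjoint_additive
    have : PreservesColimits G := adj.leftAdjoint_preservesColimits
    obtain ⟨N₁, a, ha⟩ := hF Y₁
    obtain ⟨N₂, b, hb⟩ := hF Y₂
    -- A presentation of `Y₂` by objects in the image of `F` whose generators include those of `Y₁`;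
    -- right exactness of `G` preserves it.
    let s : F.obj N₁ ⊞ F.obj N₂ ⟶ Y₂ := biprod.desc (a ≫ i) b
    obtain ⟨N₃, t, ht⟩ := hF (kernel s)
    let q : F.obj N₃ ⟶ F.obj N₁ ⊞ F.obj N₂ := t ≫ kernel.ι s
    have hs : Epi s := epi_of_epi_fac (f := biprod.inr) (biprod.inr_desc _ _)
    have hqs : q ≫ s = 0 := by simp [q]
    have hex : (ShortComplex.mk q s hqs).Exact := by
      rw [ShortComplex.exact_iff_exact_up_to_refinements]
      intro T x hx
      obtain ⟨T', π, hπ, y, hy⟩ := surjective_up_to_refinements_of_epi t (kernel.lift s x hx)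
      refine ⟨T', π, hπ, y, ?_⟩
      dsimp only [q]
      rw [← reassoc_of% hy, kernel.lift_ι]
    have hGex : (ShortComplex.mk (G.map q) (G.map s) (by rw [← G.map_comp, hqs, G.map_zero])).Exact :=
      (hex.map_of_epi_of_preservesCokernel G hs inferInstance :)
    have hrel : q ≫ biprod.fst ≫ a ≫ i = -(q ≫ biprod.snd ≫ b) := by
      rw [eq_neg_iff_add_eq_zero, ← hqs]
      dsimp only [s]
      rw [biprod.desc_eq, Preadditive.comp_add]
    -- On `F (ker v)` the relations involve only generators of `Y₁`; they hold already in `Y₁`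
    -- because `i` is mono.
    obtain ⟨v, hv⟩ := F.map_surjective (q ≫ biprod.snd)
    have hzero : F.map (kernel.ι v) ≫ q ≫ biprod.fst ≫ a = 0 := by
      rw [← cancel_mono i]
      simp only [Category.assoc, zero_comp]
      rw [hrel, Preadditive.comp_neg, reassoc_of% hv.symm, ← F.map_comp_assoc, kernel.condition,
        F.map_zero, zero_comp, neg_zero]
    rw [Preadditive.mono_iff_cancel_zero]
    intro T x hx
    obtain ⟨T₁, π₁, _, x₁, hx₁⟩ := surjective_up_to_refinements_of_epi (G.map a) x
    obtain ⟨T₂, π₂, _, z, hz⟩ := hGex.exact_up_to_refinements (x₁ ≫ G.map biprod.inl) (by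
      dsimp only [s]
      rw [Category.assoc, ← G.map_comp, biprod.inl_desc, G.map_comp, ← reassoc_of% hx₁, hx,
        comp_zero])
    dsimp only at z hz
    have hz₁ : z ≫ G.map (q ≫ biprod.fst) = π₂ ≫ x₁ := by
      rw [G.map_comp, ← reassoc_of% hz, ← G.map_comp, biprod.inl_fst, G.map_id, Category.comp_id]
    have hz₂ : z ≫ G.map (F.map v) = 0 := by
      rw [hv, G.map_comp, ← reassoc_of% hz, ← G.map_comp, biprod.inl_snd, G.map_zero, comp_zero,
        comp_zero]
    -- Left exactness enters here: since `G F ≅ 𝟭`, a map killed by `G (F v)` factors through `G (F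
    -- (ker v))`.
    have hz₃ : (z ≫ adj.counit.app N₃) ≫ v = 0 := by
      have := adj.counit_naturality v
      rw [Category.assoc, ← this, reassoc_of% hz₂, zero_comp]
    have hz₄ : z = kernel.lift v _ hz₃ ≫ inv (adj.counit.app (kernel v)) ≫
        G.map (F.map (kernel.ι v)) := by
      rw [← cancel_mono (adj.counit.app N₃)]
      simp
    rw [← cancel_epi π₁, ← cancel_epi π₂, hx₁, ← reassoc_of% hz₁, hz₄]
    simp only [Category.assoc, comp_zero]
    rw [← G.map_comp, ← G.map_comp, Category.assoc, hzero, G.map_zero, comp_zero, comp_zero]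

theorem preservesFiniteLimits_leftAdjoint
    (hF : ∀ Y : B, ∃ (N : A) (p : F.obj N ⟶ Y), Epi p) : PreservesFiniteLimits G := by
  have : G.Additive := adj.left_adjoint_additive
  have : PreservesColimits G := adj.leftAdjoint_preservesColimits
  have := preservesMonomorphisms_leftAdjoint adj hF
  have := Functor.preservesHomology_of_preservesMonos_and_cokernels G
  exact G.preservesFiniteLimits_of_preservesHomology

end LeftAdjoint

/-! ### Dimension under triangulated functors. -/

section TriangulatedDimension

open Pretriangulated ObjectProperty

variable {C D : Type*} [Category* C] [Category* D]

theorem prop_obj_of_retractClosure {P : ObjectProperty C} {Q : ObjectProperty D} (F : C ⥤ D)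
    (h : P ≤ Q.inverseImage F) : P.retractClosure ≤ Q.retractClosure.inverseImage F := by
  rintro X ⟨Y, hY, ⟨r⟩⟩
  exact ⟨F.obj Y, h _ hY, ⟨r.map F⟩⟩

variable [HasZeroObject C] [HasZeroObject D]
  [HasShift C ℤ] [HasShift D ℤ] [Preadditive C] [Preadditive D]
  [∀ n : ℤ, (shiftFunctor C n).Additive] [∀ n : ℤ, (shiftFunctor D n).Additive]
  [Pretriangulated C] [Pretriangulated D]

variable (F : C ⥤ D) [F.CommShift ℤ] [F.IsTriangulated]

theorem prop_obj_of_binaryProductsClosure {P : ObjectProperty C} {Q : ObjectProperty D}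
    (h : P ≤ Q.inverseImage F) :
    P.binaryProductsClosure ≤ Q.binaryProductsClosure.inverseImage F := by
  intro X hX
  induction hX with
  | of_mem X hX => exact limitsClosure.of_mem _ (h _ hX)
  | of_isoClosure e _ hX' => exact limitsClosure.of_isoClosure (F.mapIso e) hX'
  | of_limitPresentation pres _ hX' => exact limitsClosure.of_limitPresentation (a := ()) (pres.map F) hX'

theorem prop_obj_of_triangEnvelopeIter {P : ObjectProperty C} {Q : ObjectProperty D}
    (h : P ≤ Q.inverseImage F) (n : ℕ) :
    P.triangEnvelopeIter n ≤ (Q.triangEnvelopeIter n).inverseImage F := by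
  have h₀ : (P.shiftClosure ℤ).binaryProductsClosure.retractClosure ≤
      (Q.shiftClosure ℤ).binaryProductsClosure.retractClosure.inverseImage F := by
    refine prop_obj_of_retractClosure F (prop_obj_of_binaryProductsClosure F ?_)
    rw [shiftClosure_le_iff]
    exact h.trans fun X hX => Q.le_shiftClosure _ hX
  induction n with
  | zero => simpa only [triangEnvelopeIter_zero] using h₀
  | succ n ih =>
    rw [triangEnvelopeIter_succ, triangEnvelopeIter_succ]
    refine prop_obj_of_retractClosure F ?_
    rintro X ⟨Y, Z, f, g, k, hT, hY, hZ⟩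
    exact ⟨_, _, _, _, _, F.map_distinguished _ hT, h₀ _ hY, ih _ hZ⟩

/-- The dimension of triangulated categories does not increase along essentially surjective
triangulated functors. -/
theorem triangulatedDim_le_of_essSurj [F.EssSurj] : triangulatedDim D ≤ triangulatedDim C := by
  refine le_iInf₂ fun n ⟨X, hX⟩ => iInf₂_le n ⟨F.obj X, ?_⟩
  rw [eq_top_iff]
  intro Y _
  have hY : (singleton X).triangEnvelopeIter n (F.objPreimage Y) := by
    rw [hX]
    trivial
  refine prop_of_iso _ (F.objObjPreimageIso Y) (prop_obj_of_triangEnvelopeIter F ?_ n _ hY)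
  intro Z hZ
  obtain rfl := (singleton_iff _ _).1 hZ
  exact (singleton_iff _ _).2 rfl

end TriangulatedDimension

/-! ### Exact functors on bounded derived categories. -/

section DerivedFunctor

open DerivedCategory

variable {A : Type*} {B : Type*} [Category* A] [Category* B] [Abelian A] [Abelian B]
  [HasDerivedCategory.{w} A] [HasDerivedCategory.{w'} B]
  (G : B ⥤ A) [G.Additive] [PreservesFiniteLimits G] [PreservesFiniteColimits G]

theorem bounded_iff_exists (X : DerivedCategory A) :
    (TStructure.t (C := A)).bounded X ↔ ∃ (a b : ℤ) (K : CochainComplex A ℤ) (_ : K.IsStrictlyGE a)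
      (_ : K.IsStrictlyLE b), Nonempty (X ≅ Q.obj K) := by
  constructor
  · rintro ⟨⟨a, ha⟩, b, hb⟩
    have : X.IsGE a := ha
    have : X.IsLE b := hb
    exact ⟨a, b, X.exists_iso_Q_obj_of_isGE_of_isLE a b⟩
  · rintro ⟨a, b, K, _, _, ⟨e⟩⟩
    exact ⟨⟨a, ⟨K, e, inferInstance⟩⟩, b, ⟨K, e, inferInstance⟩⟩

theorem bounded_mapDerivedCategory (X : DerivedCategory B)
    (hX : (TStructure.t (C := B)).bounded X) :
    (TStructure.t (C := A)).bounded (G.mapDerivedCategory.obj X) := by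
  rw [bounded_iff_exists] at hX ⊢
  obtain ⟨a, b, K, _, _, ⟨e⟩⟩ := hX
  exact ⟨a, b, (G.mapHomologicalComplex _).obj K, inferInstance, inferInstance,
    ⟨G.mapDerivedCategory.mapIso e ≪≫ G.mapDerivedCategoryFactors.app K⟩⟩

/-- The functor between bounded derived categories induced by an exact functor. -/
noncomputable def mapBoundedDerivedCategory :
    BoundedDerivedCategory B ⥤ BoundedDerivedCategory A :=
  (TStructure.t (C := A)).bounded.lift
    ((TStructure.t (C := B)).bounded.ι ⋙ G.mapDerivedCategory)
    fun X => bounded_mapDerivedCategory G X.obj X.property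

noncomputable instance : (mapBoundedDerivedCategory G).CommShift ℤ := by
  delta mapBoundedDerivedCategory
  infer_instance

instance : (mapBoundedDerivedCategory G).IsTriangulated := by
  delta mapBoundedDerivedCategory
  infer_instance

/-- A bounded complex `K` is the image of the complex obtained by applying `F` termwise. Exactness
of `F` plays no role, since `F` need not act on derived categories. -/
theorem essSurj_mapBoundedDerivedCategory (F : A ⥤ B) [F.Additive] (e : F ⋙ G ≅ 𝟭 A) :
    (mapBoundedDerivedCategory G).EssSurj where
  mem_essImage X := by
    obtain ⟨a, b, K, _, _, ⟨i⟩⟩ := (bounded_iff_exists X.obj).1 X.property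
    let L : CochainComplex B ℤ := (F.mapHomologicalComplex _).obj K
    let j : (G.mapHomologicalComplex _).obj L ≅ K :=
      HomologicalComplex.Hom.isoOfComponents (fun n => e.app (K.X n)) fun n m _ =>
        (e.hom.naturality (K.d n m)).symm
    refine ⟨⟨Q.obj L, (bounded_iff_exists _).2 ⟨a, b, L, inferInstance, inferInstance,
      ⟨Iso.refl _⟩⟩⟩, ⟨ObjectProperty.isoMk _ ?_⟩⟩
    exact G.mapDerivedCategoryFactors.app L ≪≫ Q.mapIso j ≪≫ i.symm

end DerivedFunctor

/-! ### Finite direct sums in the closure of an object. -/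

section Closure

open Pretriangulated ObjectProperty

variable {C : Type*} [Category* C] [HasZeroObject C] [HasShift C ℤ] [Preadditive C]
  [∀ n : ℤ, (shiftFunctor C n).Additive] [Pretriangulated C]

theorem retractClosure_binaryProductsClosure_biprod (P : ObjectProperty C) {X Y : C}
    (hX : P.binaryProductsClosure.retractClosure X)
    (hY : P.binaryProductsClosure.retractClosure Y) :
    P.binaryProductsClosure.retractClosure (X ⊞ Y) := by
  obtain ⟨X', hX', ⟨r⟩⟩ := hX
  obtain ⟨Y', hY', ⟨s⟩⟩ := hY
  exact ⟨X' ⊞ Y', prop_of_isLimit_binaryFan _ (BinaryBiproduct.isLimit X' Y') hX' hY',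
    ⟨⟨biprod.map r.i s.i, biprod.map r.r s.r, by ext <;> simp⟩⟩⟩

theorem isClosedUnderFiniteProducts_of_biprod (P : ObjectProperty C) [P.IsClosedUnderIsomorphisms]
    [P.ContainsZero] (hP : ∀ X Y, P X → P Y → P (X ⊞ Y)) : P.IsClosedUnderFiniteProducts := by
  have : P.IsClosedUnderBinaryProducts := .mk' (by
    rintro _ ⟨F, hF⟩
    exact P.prop_of_iso (biprod.isoProd _ _ ≪≫ (HasLimit.isoOfNatIso (diagramIsoPair F)).symm)
      (hP _ _ (hF ⟨.left⟩) (hF ⟨.right⟩)))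
  exact .mk'

/-- Nonemptiness supplies the empty sum, because zero is a direct factor of every object. -/
instance (P : ObjectProperty C) [P.Nonempty] :
    P.binaryProductsClosure.retractClosure.IsClosedUnderFiniteProducts :=
  have : P.binaryProductsClosure.Nonempty := .mono (P.le_limitsClosure _)
  isClosedUnderFiniteProducts_of_biprod _ fun _ _ => retractClosure_binaryProductsClosure_biprod P

variable {B : Type*} [Category* B] [Preadditive B] (H : C ⥤ B) [H.Additive]

theorem isIso_map_biprod_inl {X Y : C} (hY : IsZero (H.obj Y)) :
    IsIso (H.map (biprod.inl : X ⟶ X ⊞ Y)) := by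
  refine ⟨H.map biprod.fst, by rw [← H.map_comp, biprod.inl_fst, H.map_id], ?_⟩
  have h := congrArg H.map (biprod.total (X := X) (Y := Y))
  rw [H.map_add, H.map_comp, H.map_comp, hY.eq_of_tgt (H.map biprod.snd) 0, zero_comp, add_zero,
    H.map_id] at h
  exact h

theorem isIso_map_biprod_inr {X Y : C} (hX : IsZero (H.obj X)) :
    IsIso (H.map (biprod.inr : Y ⟶ X ⊞ Y)) := by
  refine ⟨H.map biprod.snd, by rw [← H.map_comp, biprod.inr_snd, H.map_id], ?_⟩
  have h := congrArg H.map (biprod.total (X := X) (Y := Y))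
  rw [H.map_add, H.map_comp, H.map_comp, hX.eq_of_tgt (H.map biprod.fst) 0, zero_comp, zero_add,
    H.map_id] at h
  exact h

end Closure

/-! ### Lifting maps from projectives to cohomology. -/

section SingleLift

open DerivedCategory

variable {B : Type u} [Category.{v} B] [Abelian B]

/-- Projectivity lifts `π` from homology to cycles, and a map into the cycles is a chain map from a
single-degree complex. -/
theorem exists_mkHomFromSingle {P : B} [Projective P] (K : CochainComplex B ℤ) (i : ℤ)
    (π : P ⟶ K.homology i) :
    ∃ f : (HomologicalComplex.single B (.up ℤ) i).obj P ⟶ K,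
      (HomologicalComplex.singleObjHomologySelfIso (.up ℤ) i P).hom ≫ π =
        HomologicalComplex.homologyMap f i := by
  let c : P ⟶ K.cycles i := Projective.factorThru π (K.homologyπ i)
  have hc : c ≫ K.homologyπ i = π := Projective.factorThru_comp _ _
  let f := HomologicalComplex.mkHomFromSingle (c ≫ K.iCycles i) (fun k _ => by simp)
  refine ⟨f, ?_⟩
  have h : HomologicalComplex.cyclesMap f i =
      (HomologicalComplex.singleObjCyclesSelfIso (.up ℤ) i P).hom ≫ c := by
    rw [← cancel_mono (K.iCycles i), HomologicalComplex.cyclesMap_i,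
      HomologicalComplex.mkHomFromSingle_f, HomologicalComplex.singleObjCyclesSelfIso_hom]
    simp only [Category.assoc]
  rw [← cancel_epi (HomologicalComplex.homologyπ _ i), HomologicalComplex.homologyπ_naturality, h,
    HomologicalComplex.homologyπ_singleObjHomologySelfIso_hom_assoc, Category.assoc, hc]

variable [HasDerivedCategory.{w} B]

/-- A morphism from a projective object to the cohomology of an object of the derived category
lifts to a morphism from a complex concentrated in one degree. -/
theorem exists_singleFunctor_hom {P : B} [Projective P] (X : DerivedCategory B) (i : ℤ)
    (π : P ⟶ (homologyFunctor B i).obj X) :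
    ∃ (f : (singleFunctor B i).obj P ⟶ X)
      (e : (homologyFunctor B i).obj ((singleFunctor B i).obj P) ≅ P),
      e.hom ≫ π = (homologyFunctor B i).map f := by
  let K := Q.objPreimage X
  let j : Q.obj K ≅ X := Q.objObjPreimageIso X
  let b : (homologyFunctor B i).obj (Q.obj K) ≅ K.homology i := (homologyFunctorFactors B i).app K
  obtain ⟨f, hf⟩ := exists_mkHomFromSingle K i
    (π ≫ ((homologyFunctor B i).mapIso j).inv ≫ b.hom)
  let a : (homologyFunctor B i).obj (Q.obj ((HomologicalComplex.single B (.up ℤ) i).obj P)) ≅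
      ((HomologicalComplex.single B (.up ℤ) i).obj P).homology i :=
    (homologyFunctorFactors B i).app _
  have h : (homologyFunctor B i).map (Q.map f) ≫ b.hom =
      a.hom ≫ HomologicalComplex.homologyMap f i := homologyFunctorFactors_hom_naturality f i
  refine ⟨Q.map f ≫ j.hom, a ≪≫ HomologicalComplex.singleObjHomologySelfIso (.up ℤ) i P, ?_⟩
  change (a.hom ≫ _) ≫ π = (homologyFunctor B i).map (Q.map f ≫ j.hom)
  rw [← hf] at h
  rw [Functor.map_comp, ← cancel_mono ((homologyFunctor B i).mapIso j).inv, ← cancel_mono b.hom]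
  simp only [Category.assoc, Functor.mapIso_inv] at h ⊢
  rw [← h, Iso.map_hom_inv_id_assoc]

theorem isZero_homology_singleFunctor (P : B) {i j : ℤ} (h : j ≠ i) :
    IsZero ((homologyFunctor B j).obj ((singleFunctor B i).obj P)) := by
  rcases lt_or_gt_of_ne h with h | h
  · exact isZero_of_isGE _ i j h
  · exact isZero_of_isLE _ i j h

end SingleLift

/-! ### Covering the cohomology of a bounded complex. -/

section Bounded

open DerivedCategory Pretriangulated

variable {B : Type u} [Category.{v} B] [Abelian B] [HasDerivedCategory.{w} B]

/-- The cohomology functors on the bounded derived category. -/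
noncomputable abbrev boundedHomology (B : Type u) [Category.{v} B] [Abelian B]
    [HasDerivedCategory.{w} B] (i : ℤ) : BoundedDerivedCategory B ⥤ B :=
  (TStructure.t (C := B)).bounded.ι ⋙ homologyFunctor B i

/-- The objects of the bounded derived category concentrated in one degree. -/
noncomputable def boundedSingle (B : Type u) [Category.{v} B] [Abelian B]
    [HasDerivedCategory.{w} B] (i : ℤ) : B ⥤ BoundedDerivedCategory B :=
  (TStructure.t (C := B)).bounded.lift (singleFunctor B i)
    fun X => ⟨⟨i, inferInstanceAs (((singleFunctor B i).obj X).IsGE i)⟩,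
      i, inferInstanceAs (((singleFunctor B i).obj X).IsLE i)⟩

instance (i : ℤ) : (boundedSingle B i).Additive where
  map_add {X Y f g} := by
    refine ObjectProperty.hom_ext _ ?_
    exact (singleFunctor B i).map_add

theorem nonempty_shift_boundedSingle_iso (P : B) (i : ℤ) :
    Nonempty (((boundedSingle B 0).obj P)⟦-i⟧ ≅ (boundedSingle B i).obj P) :=
  ⟨ObjectProperty.isoMk _ (((TStructure.t (C := B)).bounded.ι.commShiftIso (-i)).app _ ≪≫
    ((singleFunctors B).shiftIso (-i) i 0 (by lia)).app P)⟩

theorem BoundedDerivedCategory.exists_isZero_homology (X : BoundedDerivedCategory B) :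
    ∃ s : Finset ℤ, ∀ i ∉ s, IsZero ((boundedHomology B i).obj X) := by
  obtain ⟨⟨a, ha⟩, b, hb⟩ := X.property
  have : X.obj.IsGE a := ha
  have : X.obj.IsLE b := hb
  refine ⟨Finset.Icc a b, fun i hi => ?_⟩
  rw [Finset.mem_Icc, not_and_or, not_le, not_le] at hi
  rcases hi with hi | hi
  · exact isZero_of_isGE X.obj a i hi
  · exact isZero_of_isLE X.obj b i hi

theorem exists_boundedSingle_hom {P : B} [Projective P] (X : BoundedDerivedCategory B) (i : ℤ)
    (π : P ⟶ (boundedHomology B i).obj X) :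
    ∃ (f : (boundedSingle B i).obj P ⟶ X)
      (e : (boundedHomology B i).obj ((boundedSingle B i).obj P) ≅ P),
      e.hom ≫ π = (boundedHomology B i).map f := by
  obtain ⟨f, e, he⟩ := exists_singleFunctor_hom X.obj i π
  exact ⟨ObjectProperty.homMk f, e, he⟩

/-- `Z` is the sum over `i ∈ s` of `P i` placed in degree `i`. Each new summand leaves the
cohomology in all other degrees unchanged. -/
theorem exists_hom_of_homology (E : ObjectProperty (BoundedDerivedCategory B)) [E.ContainsZero]
    (hE : ∀ X Y, E X → E Y → E (X ⊞ Y)) (X : BoundedDerivedCategory B) (P : ℤ → B)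
    [∀ i, Projective (P i)] (hP : ∀ i, E ((boundedSingle B i).obj (P i)))
    (π : ∀ i, P i ⟶ (boundedHomology B i).obj X) (s : Finset ℤ) :
    ∃ (Z : BoundedDerivedCategory B) (f : Z ⟶ X), E Z ∧
      (∀ i ∈ s, ∃ e : (boundedHomology B i).obj Z ≅ P i,
        e.hom ≫ π i = (boundedHomology B i).map f) ∧
      ∀ i ∉ s, IsZero ((boundedHomology B i).obj Z) := by
  induction s using Finset.induction_on with
  | empty =>
    obtain ⟨Z, hZ, hE'⟩ := E.exists_prop_of_containsZero
    exact ⟨Z, 0, hE', by simp, fun i _ => (boundedHomology B i).map_isZero hZ⟩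
  | insert j s hj ih =>
    obtain ⟨Z, f, hZ, hf, hf'⟩ := ih
    obtain ⟨g, e, he⟩ := exists_boundedSingle_hom X j (π j)
    refine ⟨Z ⊞ (boundedSingle B j).obj (P j), biprod.desc f g, hE _ _ hZ (hP j), ?_, ?_⟩
    · intro i hi
      rcases Finset.mem_insert.1 hi with rfl | hi
      · have := isIso_map_biprod_inr (Y := (boundedSingle B i).obj (P i)) (boundedHomology B i)
          (hf' i hj)
        refine ⟨(asIso ((boundedHomology B i).map
          (biprod.inr : (boundedSingle B i).obj (P i) ⟶ Z ⊞ _))).symm ≪≫ e, ?_⟩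
        rw [Iso.trans_hom, Iso.symm_hom, asIso_inv, Category.assoc, IsIso.inv_comp_eq,
          ← Functor.map_comp, biprod.inr_desc]
        exact he
      · have hij : i ≠ j := fun h => hj (h ▸ hi)
        have := isIso_map_biprod_inl (X := Z) (Y := (boundedSingle B j).obj (P j))
          (boundedHomology B i) (isZero_homology_singleFunctor (P j) hij)
        obtain ⟨e, he⟩ := hf i hi
        refine ⟨(asIso ((boundedHomology B i).map (biprod.inl : Z ⟶ Z ⊞ _))).symm ≪≫ e, ?_⟩
        rw [Iso.trans_hom, Iso.symm_hom, asIso_inv, Category.assoc, IsIso.inv_comp_eq,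
          ← Functor.map_comp, biprod.inl_desc]
        exact he
    · intro i hi
      rw [Finset.mem_insert, not_or] at hi
      have := isIso_map_biprod_inl (X := Z) (Y := (boundedSingle B j).obj (P j))
        (boundedHomology B i) (isZero_homology_singleFunctor (P j) hi.1)
      exact (hf' i hi.2).of_iso (asIso ((boundedHomology B i).map (biprod.inl : Z ⟶ Z ⊞ _))).symm

/-- The objects having a resolution of length `n` by finite direct sums of copies of `P₀`, up to
direct factors in the last term. -/
inductive HasPowerResolution (P₀ : B) : ℕ → B → Prop
  | of_retract {Y : B} (m : ℕ) (r : Retract Y (power P₀ m)) : HasPowerResolution P₀ 0 Y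
  | of_shortExact {n : ℕ} {K Y : B} (m : ℕ) (i : K ⟶ power P₀ m) (p : power P₀ m ⟶ Y)
      (w : i ≫ p = 0) (hS : (ShortComplex.mk i p w).ShortExact) (h : HasPowerResolution P₀ n K) :
      HasPowerResolution P₀ (n + 1) Y

omit [HasDerivedCategory.{w} B]

attribute [local instance] Abelian.hasFiniteBiproducts

theorem HasPowerResolution.of_iso {P₀ : B} {n : ℕ} {Y Y' : B} (h : HasPowerResolution P₀ n Y)
    (e : Y ≅ Y') : HasPowerResolution P₀ n Y' := by
  cases h with
  | of_retract m r => exact .of_retract m ((Retract.ofIso e.symm).trans r)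
  | of_shortExact m i p w hS h =>
    refine .of_shortExact m i (p ≫ e.hom) (by rw [reassoc_of% w, zero_comp]) ?_ h
    let ε : ShortComplex.mk i p w ≅
        ShortComplex.mk i (p ≫ e.hom) (by rw [reassoc_of% w, zero_comp]) :=
      ShortComplex.isoMk (Iso.refl _) (Iso.refl _) e (by simp) (by simp)
    exact ShortComplex.shortExact_of_iso ε hS

theorem HasPowerResolution.of_isZero {P₀ Y : B} (hY : IsZero Y) (n : ℕ) :
    HasPowerResolution P₀ n Y := by
  induction n generalizing Y with
  | zero => exact .of_retract 0 (hY.retract _)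
  | succ n ih =>
    have h0 : IsZero (power P₀ 0) := by
      rw [IsZero.iff_id_eq_zero]
      exact biproduct.hom_ext _ _ fun i => i.elim0
    have : Epi (0 : power P₀ 0 ⟶ Y) := IsZero.epi hY _
    exact .of_shortExact 0 (kernel.ι (0 : power P₀ 0 ⟶ Y)) 0 (kernel.condition _)
      (ShortComplex.shortExact_kernel _) (ih (IsZero.of_mono (kernel.ι (0 : power P₀ 0 ⟶ Y)) h0))

instance projective_power (P₀ : B) [Projective P₀] (m : ℕ) : Projective (power P₀ m) where
  factors f e _ := ⟨biproduct.desc fun i => Projective.factorThru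
    (biproduct.ι (fun _ : Fin m => P₀) i ≫ f) e, by ext; simp⟩

theorem HasPowerResolution.exists_epi {P₀ : B} {n : ℕ} {Y : B}
    (h : HasPowerResolution P₀ (n + 1) Y) :
    ∃ (m : ℕ) (p : power P₀ m ⟶ Y), Epi p ∧ HasPowerResolution P₀ n (kernel p) := by
  cases h with
  | of_shortExact m i p w hS h =>
    have := hS.epi_g
    have := hS.mono_f
    exact ⟨m, p, hS.epi_g, h.of_iso
      (hS.fIsKernel.conePointUniqueUpToIso (limit.isLimit _))⟩

end Bounded

/-! ### Generation of the bounded derived category by a projective. -/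

section Generation

open DerivedCategory Pretriangulated ObjectProperty

variable {B : Type u} [Category.{v} B] [Abelian B] [HasDerivedCategory.{w} B]

attribute [local instance] Abelian.hasFiniteBiproducts

/-- An object of the bounded derived category whose cohomology objects have resolutions of length `n`
by finite direct sums of copies of a projective object `P₀` is built from `P₀` in `n` extensions. -/
theorem triangEnvelopeIter_boundedSingle {P₀ : B} [Projective P₀] (n : ℕ)
    (X : BoundedDerivedCategory B)
    (hX : ∀ i, HasPowerResolution P₀ n ((boundedHomology B i).obj X)) :
    (singleton ((boundedSingle B 0).obj P₀)).triangEnvelopeIter n X := by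
  set E := (singleton ((boundedSingle B 0).obj P₀)).triangEnvelopeIter 0 with hE
  have hE' : E = ((singleton ((boundedSingle B 0).obj P₀)).shiftClosure
      ℤ).binaryProductsClosure.retractClosure := triangEnvelopeIter_zero _
  have : ((singleton ((boundedSingle B 0).obj P₀)).shiftClosure ℤ).Nonempty :=
    .mono (le_shiftClosure _)
  have hE₀ : E.ContainsZero := by
    rw [hE']
    infer_instance
  have hEfin : E.IsClosedUnderFiniteProducts := by
    rw [hE']
    infer_instance
  have hEbi : ∀ X Y, E X → E Y → E (X ⊞ Y) := by
    rw [hE']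
    exact fun _ _ => retractClosure_binaryProductsClosure_biprod _
  have hEsingle (i : ℤ) : E ((boundedSingle B i).obj P₀) := by
    obtain ⟨e⟩ := nonempty_shift_boundedSingle_iso P₀ i
    refine E.prop_of_iso e (E.le_shift (-i) _ (le_triangEnvelopeIter _ 0 _ ?_))
    exact (singleton_iff _ _).2 rfl
  have hEpower (i : ℤ) (m : ℕ) : E ((boundedSingle B i).obj (power P₀ m)) := by
    have := Functor.hasBiproduct_of_preserves (boundedSingle B i) (fun _ : Fin m => P₀)
    exact E.prop_of_iso ((boundedSingle B i).mapBiproduct (fun _ : Fin m => P₀)).symm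
      (E.prop_of_isLimit_fan (biproduct.isLimit _) fun _ => hEsingle i)
  have step (P : ℤ → B) [∀ i, Projective (P i)] (hP : ∀ i, E ((boundedSingle B i).obj (P i)))
    (π : ∀ i, P i ⟶ (boundedHomology B i).obj X) :
    ∃ (Z : BoundedDerivedCategory B) (f : Z ⟶ X), E Z ∧ ∀ i,
      (∃ e : (boundedHomology B i).obj Z ≅ P i, e.hom ≫ π i = (boundedHomology B i).map f) ∨
      (IsZero ((boundedHomology B i).obj X) ∧ IsZero ((boundedHomology B i).obj Z)) := by
    obtain ⟨s, hs⟩ := X.exists_isZero_homology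
    obtain ⟨Z, f, hZ, hf, hf'⟩ := exists_hom_of_homology E hEbi X P hP π s
    refine ⟨Z, f, hZ, fun i => ?_⟩
    by_cases hi : i ∈ s
    · exact Or.inl (hf i hi)
    · exact Or.inr ⟨hs i hi, hf' i hi⟩
  cases n with
  | zero =>
    have hret (i : ℤ) : ∃ m, Nonempty (Retract ((boundedHomology B i).obj X) (power P₀ m)) := by
      cases hX i with
      | of_retract m r => exact ⟨m, ⟨r⟩⟩
    choose m r using hret
    have hproj (i : ℤ) : Projective ((boundedHomology B i).obj X) := (r i).some.projective
    -- The cohomology is itself projective, so lifting identities yields a quasi-isomorphism.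
    obtain ⟨Z, f, hZ, hf⟩ := step (fun i => (boundedHomology B i).obj X)
      (fun i => E.prop_of_retract ((r i).some.map (boundedSingle B i)) (hEpower i (m i)))
      (fun i => 𝟙 _)
    have : IsIso ((TStructure.t (C := B)).bounded.ι.map f) := by
      rw [isIso_iff]
      intro i
      change IsIso ((boundedHomology B i).map f)
      rcases hf i with ⟨e, he⟩ | ⟨h₁, h₂⟩
      · rw [← he, Category.comp_id]
        infer_instance
      · exact ⟨0, h₂.eq_of_src _ _, h₁.eq_of_src _ _⟩
    have : IsIso f := isIso_of_reflects_iso f (TStructure.t (C := B)).bounded.ι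
    exact E.prop_of_iso (asIso f) hZ
  | succ n =>
    choose m p hp hK using fun i => (hX i).exists_epi
    obtain ⟨Z, f, hZ, hf⟩ := step (fun i => power P₀ (m i)) (fun i => hEpower i (m i)) p
    obtain ⟨K, g, h, hT⟩ := distinguished_cocone_triangle₁ f
    have hepi (i : ℤ) : Epi ((boundedHomology B i).map f) := by
      rcases hf i with ⟨e, he⟩ | ⟨h₁, -⟩
      · rw [← he]
        infer_instance
      · exact IsZero.epi h₁ _
    have hT' := (TStructure.t (C := B)).bounded.ι.map_distinguished _ hT
    -- Surjectivity in degree `i - 1` kills the connecting map, so the cohomology of `K` is the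
    -- kernel of that of `f`.
    have hmono (i : ℤ) : Mono ((boundedHomology B i).map g) :=
      (HomologySequence.mono_homologyMap_mor₁_iff _ hT' (i - 1) i (by lia)).2
        ((HomologySequence.epi_homologyMap_mor₂_iff _ hT' (i - 1) i (by lia)).1 (hepi (i - 1)))
    have hKres (i : ℤ) : HasPowerResolution P₀ n ((boundedHomology B i).obj K) := by
      rcases hf i with ⟨e, he⟩ | ⟨-, h₂⟩
      · have hex := HomologySequence.exact₂ _ hT' i
        have : Mono ((homologyFunctor B i).map
          ((TStructure.t (C := B)).bounded.ι.mapTriangle.obj (Triangle.mk g f h)).mor₁) := hmono i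
        have e₁ : (boundedHomology B i).obj K ≅ kernel ((boundedHomology B i).map f) :=
          hex.fIsKernel.conePointUniqueUpToIso (limit.isLimit _)
        have e₂ : kernel ((boundedHomology B i).map f) ≅ kernel (p i) :=
          kernelIsoOfEq he.symm ≪≫ kernelIsIsoComp e.hom (p i)
        exact (hK i).of_iso (e₁ ≪≫ e₂).symm
      · exact .of_isZero (IsZero.of_mono ((boundedHomology B i).map g) h₂) n
    have hK' := triangEnvelopeIter_boundedSingle n K hKres
    -- The rotated triangle exhibits `X` as an extension of `K⟦1⟧` by `Z`.
    rw [triangEnvelopeIter_succ, ← hE']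
    exact le_retractClosure _ _ ⟨Z, K⟦(1 : ℤ)⟧, f, h, _, rot_of_distTriang _ hT, hZ,
      ObjectProperty.le_shift _ 1 _ hK'⟩

end Generation

/-! ### Numerical projective dimension. -/

section ProjDim

variable {Λ : Type v} [Ring Λ]

theorem pd_le_iff (X : RightMod Λ) (n : ℕ) : pd X ≤ n ↔ HasProjectiveDimensionLE X n := by
  rw [← projectiveDimension_le_iff, pd, WithBot.unbotD_le_iff (by simp)]
  rfl

theorem pd_ne_top {X : RightMod Λ} (h : ∃ n, HasProjectiveDimensionLT X n) : pd X ≠ ⊤ := by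
  obtain ⟨n, hn⟩ := h
  have : pd X ≤ n := (pd_le_iff X n).2 (hasProjectiveDimensionLT_of_ge X n (n + 1) (by lia))
  exact ne_top_of_le_ne_top (ENat.natCast_ne_top n) this

end ProjDim

/-! ### The category `mod Γ` and the two main inequalities. -/

section FPMod

attribute [local instance] Abelian.hasFiniteBiproducts

variable {A : Type u} [Category.{v} A] [Abelian A] {M : A} (hM : IsRepresentationGenerator M)

theorem IsRepresentationGenerator.isRightCoherent (hM : IsRepresentationGenerator M) :
    IsRightCoherent (End M) :=
  have := hM.isClosedUnderKernels
  isRightCoherent_of_isClosedUnderKernels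

/-- The functor `Hom(M, -)` with values in finitely presented right `End M`-modules. -/
noncomputable def homFunctor (hM : IsRepresentationGenerator M) : A ⥤ FPMod (End M) :=
  (isFinitelyPresented (End M)).lift (preadditiveCoyonedaObj M) hM.isFinitelyPresented_hom

instance : (homFunctor hM).Faithful :=
  have := hM.faithful
  inferInstanceAs ((isFinitelyPresented (End M)).lift (preadditiveCoyonedaObj M) _).Faithful

instance : (homFunctor hM).Full :=
  have := hM.full
  inferInstanceAs ((isFinitelyPresented (End M)).lift (preadditiveCoyonedaObj M) _).Full

instance : (homFunctor hM).Additive where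
  map_add := ObjectProperty.hom_ext _ (preadditiveCoyonedaObj M).map_add

theorem projective_coyonedaObj_self (M : A) :
    Projective ((preadditiveCoyonedaObj M).obj M) := by
  have := projective_coyonedaObj_power M 1
  let r : Retract M (power M 1) :=
    ⟨biproduct.ι (fun _ : Fin 1 => M) 0, biproduct.π (fun _ : Fin 1 => M) 0, by simp⟩
  exact (r.map (preadditiveCoyonedaObj M)).projective

theorem homFunctor_presentation (Y : FPMod (End M)) :
    ∃ (m n : ℕ) (f : power M m ⟶ power M n) (π : (homFunctor hM).obj (power M n) ⟶ Y)
      (w : (homFunctor hM).map f ≫ π = 0), Nonempty (IsColimit (CokernelCofork.ofπ π w)) := by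
  obtain ⟨m, n, f, π, w, hπ, hex⟩ := exists_presentation Y.obj Y.property
  let π' : (homFunctor hM).obj (power M n) ⟶ Y := ObjectProperty.homMk π
  have w' : (homFunctor hM).map f ≫ π' = 0 := ObjectProperty.hom_ext _ w
  have hc := hex.gIsCokernel
  refine ⟨m, n, f, π', w', ⟨CokernelCofork.IsColimit.ofπ _ _
    (fun g hg => ObjectProperty.homMk (hc.desc (CokernelCofork.ofπ g.hom
      (congrArg (fun k => k.hom) hg))))
    (fun g hg => ObjectProperty.hom_ext _ (hc.fac (CokernelCofork.ofπ g.hom _) .one))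
    (fun g hg k hk => ObjectProperty.hom_ext _ ?_)⟩⟩
  rw [← cancel_epi π]
  exact (congrArg (fun k => k.hom) hk).trans
    (hc.fac (CokernelCofork.ofπ g.hom _) .one).symm

theorem homFunctor_isRightAdjoint [IsRightCoherent (End M)] : (homFunctor hM).IsRightAdjoint :=
  isRightAdjoint_of_presentation _ fun Y => by
    obtain ⟨m, n, f, π, w, h⟩ := homFunctor_presentation hM Y
    exact ⟨_, _, f, π, w, h⟩

theorem homFunctor_cover (Y : FPMod (End M)) :
    ∃ (n : ℕ) (p : (homFunctor hM).obj (power M n) ⟶ Y), Epi p := by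
  obtain ⟨m, n, f, π, w, ⟨h⟩⟩ := homFunctor_presentation hM Y
  exact ⟨n, π, Cofork.IsColimit.epi h⟩

include hM in
theorem IsRepresentationGenerator.projective_homFunctor :
    Projective ((homFunctor hM).obj M) := by
  have := hM.isClosedUnderKernels
  have := (isFinitelyPresented (End M)).preservesEpimorphisms_ι_of_isNormalMonoCategory
  have : Projective ((isFinitelyPresented (End M)).ι.obj ((homFunctor hM).obj M)) :=
    projective_coyonedaObj_self M
  exact (isFinitelyPresented (End M)).ι.projective_of_map_projective this

variable [IsRightCoherent (End M)]

/-- `Hom(M, -)` commutes with finite direct sums of copies of `M`. -/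
noncomputable def homFunctorPowerIso (n : ℕ) :
    (homFunctor hM).obj (power M n) ≅ power ((homFunctor hM).obj M) n :=
  (homFunctor hM).mapBiproduct (fun _ : Fin n => M)

include hM

/-- Coherence makes the inclusion into all modules preserve epimorphisms and kernels, so syzygies
taken in `mod Γ` have the projective dimension predicted there. -/
theorem hasPowerResolution_of_hasProjectiveDimensionLE (n : ℕ) (Y : FPMod (End M))
    (hY : HasProjectiveDimensionLE Y.obj n) :
    HasPowerResolution ((homFunctor hM).obj M) n Y := by
  have := hM.isClosedUnderKernels
  have := (isFinitelyPresented (End M)).preservesEpimorphisms_ι_of_isNormalMonoCategory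
  induction n generalizing Y with
  | zero =>
    have hproj : Projective Y.obj := projective_iff_hasProjectiveDimensionLT_one.2 hY
    obtain ⟨m, p, hp⟩ := homFunctor_cover hM Y
    have : Epi p.hom := inferInstanceAs (Epi ((isFinitelyPresented (End M)).ι.map p))
    let r : Retract Y ((homFunctor hM).obj (power M m)) :=
      ⟨ObjectProperty.homMk (Projective.factorThru (𝟙 Y.obj) p.hom), p,
        ObjectProperty.hom_ext _ (Projective.factorThru_comp _ _)⟩
    exact .of_retract m (r.trans (Retract.ofIso (homFunctorPowerIso hM m)))
  | succ n ih =>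
    obtain ⟨m, p, hp⟩ := homFunctor_cover hM Y
    have : Epi p.hom := inferInstanceAs (Epi ((isFinitelyPresented (End M)).ι.map p))
    have : PreservesLimit (parallelPair p 0) (isFinitelyPresented (End M)).ι :=
      (isFinitelyPresented (End M)).preservesKernels_ι p
    have hproj : Projective ((homFunctor hM).obj (power M m)).obj :=
      projective_coyonedaObj_power M m
    have hker : HasProjectiveDimensionLT (kernel p.hom) (n + 1) :=
      (ShortComplex.shortExact_kernel p.hom).hasProjectiveDimensionLT_X₁ (n + 1)
        (hasProjectiveDimensionLT_of_ge ((homFunctor hM).obj (power M m)).obj 1 (n + 1) (by lia)) hY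
    let e' : kernel p.hom ≅ (kernel p).obj :=
      (PreservesKernel.iso (isFinitelyPresented (End M)).ι p).symm
    have hker' : HasProjectiveDimensionLT (kernel p).obj (n + 1) :=
      hasProjectiveDimensionLT_of_iso e' (n + 1)
    have e := homFunctorPowerIso hM m
    let S : ShortComplex (FPMod (End M)) := .mk (kernel.ι p) p (kernel.condition p)
    let S' : ShortComplex (FPMod (End M)) := .mk (kernel.ι p ≫ e.hom) (e.inv ≫ p) (by simp)
    have i : S ≅ S' :=
      ShortComplex.isoMk (Iso.refl _) e (Iso.refl _) (by simp [S, S']) (by simp [S, S'])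
    exact .of_shortExact m _ _ _
      (ShortComplex.shortExact_of_iso i (ShortComplex.shortExact_kernel p)) (ih _ hker')

theorem IsRepresentationGenerator.dimDb_le : dimDb A ≤ dimDb (FPMod (End M)) := by
  have := homFunctor_isRightAdjoint hM
  let adj := Adjunction.ofIsRightAdjoint (homFunctor hM)
  have : (homFunctor hM).leftAdjoint.Additive := adj.left_adjoint_additive
  have : PreservesColimits (homFunctor hM).leftAdjoint := adj.leftAdjoint_preservesColimits
  have : PreservesFiniteLimits (homFunctor hM).leftAdjoint :=
    preservesFiniteLimits_leftAdjoint adj fun Y => by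
      obtain ⟨n, p, hp⟩ := homFunctor_cover hM Y
      exact ⟨_, p, hp⟩
  let : HasDerivedCategory.{max u v} A := HasDerivedCategory.standard A
  let : HasDerivedCategory.{v + 1} (FPMod (End M)) := HasDerivedCategory.standard _
  have := essSurj_mapBoundedDerivedCategory (homFunctor hM).leftAdjoint (homFunctor hM)
    (asIso adj.counit)
  exact triangulatedDim_le_of_essSurj (mapBoundedDerivedCategory (homFunctor hM).leftAdjoint)

theorem IsRepresentationGenerator.dimDb_FPMod_le :
    dimDb (FPMod (End M)) ≤ ⨆ X : FPMod (End M), pd X.obj := by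
  have := hM.projective_homFunctor
  generalize hs : ⨆ X : FPMod (End M), pd X.obj = s
  induction s using ENat.recTopCoe with
  | top => exact le_top
  | coe n =>
    let : HasDerivedCategory.{v + 1} (FPMod (End M)) := HasDerivedCategory.standard _
    -- The generator is `Hom(M, M)`, that is `Γ` in degree zero.
    refine iInf₂_le n ⟨(boundedSingle _ 0).obj ((homFunctor hM).obj M), eq_top_iff.2 fun X _ => ?_⟩
    refine triangEnvelopeIter_boundedSingle n X fun i => ?_
    refine hasPowerResolution_of_hasProjectiveDimensionLE hM n _ ((pd_le_iff _ n).1 ?_)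
    exact (le_iSup (fun X : FPMod (End M) => pd X.obj) _).trans hs.le

end FPMod

end RepGen

theorem mainTheorem5 {A : Type u} [Category.{v} A] [Abelian A] (M : A)
    (hM : RepGen.IsRepresentationGenerator M) :
    ∃ _ : RepGen.IsRightCoherent (End M),
      (∀ X : RepGen.FPMod (End M), RepGen.pd X.obj ≠ ⊤) ∧
      RepGen.dimDb A ≤ RepGen.dimDb (RepGen.FPMod (End M)) ∧
      RepGen.dimDb (RepGen.FPMod (End M)) ≤ ⨆ X : RepGen.FPMod (End M), RepGen.pd X.obj ∧
      (⨆ X : RepGen.FPMod (End M), RepGen.pd X.obj) ≤ RepGen.glDim (End M) := by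
  have := hM.isRightCoherent
  exact ⟨this, fun X => RepGen.pd_ne_top (hM.exists_hasProjectiveDimensionLT X.obj X.property),
    hM.dimDb_le, hM.dimDb_FPMod_le,
    iSup_le fun X => le_iSup (fun Y : RepGen.RightMod (End M) => RepGen.pd Y) X.obj⟩
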